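/- A dioid is an idempotent semiring, ordered by $a\le b\iff a+b=b$. For a monoid $M$, the family $\mathcal R M$ of regular subsets of $M$ is the least family that contains $\emptyset$ and the singletons and is closed under union, elementwise product and $A\mapsto A^*$ (the submonoid generated by $A$). An $\mathcal R$-dioid is a dioid $D$ in which every $A\in\mathcal R D$ (regular subset of the multiplicative monoid of $D$) has a least upper bound $\sum A$, and $\sum(AB)=(\sum A)(\sum B)$ for all $A,B\in\mathcal R D$; one puts $c^*:=\sum\{c\}^*$. For every monoid $M$, $\mathcal R M$ is itself an $\mathcal R$-dioid, under union and elementwise product. An $\mathcal R$-congruence on $D$ is a semiring congruence $\rho$ such that for all $S,T\in\mathcal R D$, if $S/\rho$ and $T/\rho$ generate the same downward closed subset of $D/\rho$, then $(\sum S)/\rho=(\sum T)/\rho$; the quotient of an $\mathcal R$-dioid by an $\mathcal R$-congruence is an $\mathcal R$-dioid. Let $C_2'$ be the quotient of $\mathcal R\{b,p,d,q\}^*$ by the least $\mathcal R$-congruence containing the equations $bd=1$, $pq=1$, $bq=0$, $pd=0$ (letters being read as singleton sets of words). For $\mathcal R$-dioids $K_1,K_2$ let $K_1\otimes_{\mathcal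 R}K_2$ be the quotient of $\mathcal R(K_1\times K_2)$ by the least $\mathcal R$-congruence containing the equations $A\times B=\{(\sum A,\sum B)\}$ for $A\in\mathcal R K_1$, $B\in\mathcal R K_2$; write $k\otimes c$ for the class of $\{(k,c)\}$. In $K\otimes_{\mathcal R}C_2'$ write $c$ for $1\otimes c$ with $c\in C_2'$, and let $Z$ be the centralizer of $C_2'$, i.e. the set of all elements that commute with every $1\otimes c$, $c\in C_2'$. For an $\mathcal R$-dioid $D$, the iteration $M^*$ of $M\in\mathrm{Mat}_n(D)$ is defined by recursion on $n$: the $1\times1$ matrix $(k)$ has iteration $(k^*)$, and a matrix with blocks $\begin{pmatrix}A&B\\C&E\end{pmatrix}$ ($A$, $E$ square) has iteration $$\begin{pmatrix}F^*&F^*BE^*\\E^*CF^*&E^*CF^*BE^*+E^*\end{pmatrix},\qquad F=A+BE^*C.$$ Matrices are ordered by $A\le B\iff A+B=B$, and a scalar multiplied with a matrix stands for the corresponding scalar diagonal matrix. **Lemma.** Let $K$ be an $\mathcal R$-dioid, $n\in\mathbb N$, $X\in Z^{n\times n}$, $U\in\{0,b,p\}^{n\times n}$ and $V\in\{0,d,q\}^{n\times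 n}$, all regarded as matrices over $K\otimes_{\mathcal R}C_2'$. Put $$N:=b\,(Up+X+qV)^*\,d.$$ Then: 1. $N$ is the least solution $y$ of $y\ge(UyV+X)^*$ in $\mathrm{Mat}_n(K\otimes_{\mathcal R}C_2')$. 2. $N$ is the least upper bound in $\mathrm{Mat}_n(K\otimes_{\mathcal R}C_2')$ of the set of values of all words of the Dyck language over $\{U,X,V\}$, that is, of the least set of words that contains the empty word and $X$ and is closed under concatenation and under $w\mapsto UwV$; here concatenation is interpreted by matrix multiplication and the empty word by the unit matrix. 3. All entries of $N$ belong to $Z$. -/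

import Mathlib

open scoped Pointwise

noncomputable section

namespace KleeneTensor

/-! ### Regular subsets of a monoid -/

/-- The regular subsets of a monoid `M`: the least family of subsets of `M` that contains the
empty set and the singletons and is closed under union, elementwise product and iteration,
where `A*` is the submonoid generated by `A`. -/
inductive IsRegularSet {M : Type*} [Monoid M] : Set M → Prop
  | empty : IsRegularSet ∅
  | single (a : M) : IsRegularSet {a}
  | union {A B : Set M} : IsRegularSet A → IsRegularSet B → IsRegularSet (A ∪ B)
  | mul {A B : Set M} : IsRegularSet A → IsRegularSet B → IsRegularSet (A * B)
  | star {A : Set M} : IsRegularSet A → IsRegularSet (Submonoid.closure A : Set M)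

theorem IsRegularSet.image {M N : Type*} [Monoid M] [Monoid N] (f : M →* N) {A : Set M}
    (hA : IsRegularSet A) : IsRegularSet (f '' A) := by
  induction hA with
  | empty => simpa using IsRegularSet.empty
  | single a => simpa using IsRegularSet.single (f a)
  | union _ _ ihA ihB => rw [Set.image_union]; exact ihA.union ihB
  | mul _ _ ihA ihB => rw [Set.image_mul]; exact ihA.mul ihB
  | @star A _ ih =>
    have h : f '' (Submonoid.closure A : Set M) = (Submonoid.closure (f '' A) : Set N) := by
      rw [← MonoidHom.map_mclosure]; rfl
    rw [h]; exact ih.star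

/-- Regular sets lift along surjective homomorphisms. -/
theorem IsRegularSet.exists_image_eq {M N : Type*} [Monoid M] [Monoid N] (f : M →* N)
    (hf : Function.Surjective f) {B : Set N} (hB : IsRegularSet B) :
    ∃ A : Set M, IsRegularSet A ∧ f '' A = B := by
  induction hB with
  | empty => exact ⟨∅, .empty, by simp⟩
  | single b => obtain ⟨a, rfl⟩ := hf b; exact ⟨{a}, .single a, by simp⟩
  | union _ _ ih₁ ih₂ =>
    obtain ⟨A₁, h₁, rfl⟩ := ih₁
    obtain ⟨A₂, h₂, rfl⟩ := ih₂
    exact ⟨A₁ ∪ A₂, h₁.union h₂, Set.image_union ..⟩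
  | mul _ _ ih₁ ih₂ =>
    obtain ⟨A₁, h₁, rfl⟩ := ih₁
    obtain ⟨A₂, h₂, rfl⟩ := ih₂
    exact ⟨A₁ * A₂, h₁.mul h₂, Set.image_mul ..⟩
  | star _ ih =>
    obtain ⟨A, h, rfl⟩ := ih
    refine ⟨_, h.star, ?_⟩
    rw [← MonoidHom.map_mclosure]; rfl

theorem IsRegularSet.prod {M N : Type*} [Monoid M] [Monoid N] {A : Set M} {B : Set N}
    (hA : IsRegularSet A) (hB : IsRegularSet B) : IsRegularSet (A ×ˢ B) := by
  have h : A ×ˢ B = (MonoidHom.inl M N '' A) * (MonoidHom.inr M N '' B) := by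
    ext ⟨x, y⟩
    simp [Set.mem_mul]
  rw [h]
  exact (hA.image _).mul (hB.image _)

/-! ### Dioids with suprema of regular sets

A dioid is an idempotent semiring, Mathlib's `IdemSemiring`; its order is the natural one,
`a ≤ b ↔ a + b = b`. -/

/-- A dioid in which every regular subset (of the multiplicative monoid) has a least upper bound,
and in which `∑ (A B) = (∑ A) (∑ B)` for all regular `A`, `B`. -/
class IsRDioid (D : Type*) [IdemSemiring D] : Prop where
  exists_isLUB : ∀ A : Set D, IsRegularSet A → ∃ a, IsLUB A a
  isLUB_mul : ∀ (A B : Set D) (a b : D), IsRegularSet A → IsRegularSet B →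
    IsLUB A a → IsLUB B b → IsLUB (A * B) (a * b)

/-- The iteration `c* = ∑ {c}*` in an `R`-dioid. -/
def rstar {D : Type*} [IdemSemiring D] [IsRDioid D] (c : D) : D :=
  (IsRDioid.exists_isLUB _ (IsRegularSet.single c).star).choose

theorem isLUB_rstar {D : Type*} [IdemSemiring D] [IsRDioid D] (c : D) :
    IsLUB (Submonoid.closure {c} : Set D) (rstar c) :=
  (IsRDioid.exists_isLUB _ (IsRegularSet.single c).star).choose_spec

/-! ### The dioid of regular subsets of a monoid -/

/-- The type of regular subsets of `M`. -/
def RegSet (M : Type*) [Monoid M] : Type _ := {A : Set M // IsRegularSet A}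

namespace RegSet

variable {M : Type*} [Monoid M]

/-- The singleton of an element of the monoid. -/
def single (a : M) : RegSet M := ⟨{a}, .single a⟩

instance : Zero (RegSet M) := ⟨⟨∅, .empty⟩⟩
instance : One (RegSet M) := ⟨⟨1, .single 1⟩⟩
instance : Add (RegSet M) := ⟨fun A B => ⟨A.1 ∪ B.1, A.2.union B.2⟩⟩
instance : Mul (RegSet M) := ⟨fun A B => ⟨A.1 * B.1, A.2.mul B.2⟩⟩

theorem val_zero : (0 : RegSet M).1 = ∅ := rfl
theorem val_one : (1 : RegSet M).1 = 1 := rfl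
theorem val_add (A B : RegSet M) : (A + B).1 = A.1 ∪ B.1 := rfl
theorem val_mul (A B : RegSet M) : (A * B).1 = A.1 * B.1 := rfl

instance : Semiring (RegSet M) where
  add_assoc _ _ _ := Subtype.ext (Set.union_assoc ..)
  zero_add _ := Subtype.ext (Set.empty_union _)
  add_zero _ := Subtype.ext (Set.union_empty _)
  add_comm _ _ := Subtype.ext (Set.union_comm ..)
  nsmul := nsmulRec
  left_distrib _ _ _ := Subtype.ext Set.mul_union
  right_distrib _ _ _ := Subtype.ext Set.union_mul
  zero_mul _ := Subtype.ext Set.empty_mul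
  mul_zero _ := Subtype.ext Set.mul_empty
  mul_assoc A B C := Subtype.ext (mul_assoc A.1 B.1 C.1)
  one_mul A := Subtype.ext (one_mul A.1)
  mul_one A := Subtype.ext (mul_one A.1)

instance : IdemSemiring (RegSet M) :=
  IdemSemiring.ofSemiring fun _ => Subtype.ext (Set.union_self _)

theorem le_iff {A B : RegSet M} : A ≤ B ↔ A.1 ⊆ B.1 := by
  rw [← add_eq_right_iff_le, ← Set.union_eq_right]
  exact Subtype.ext_iff

/-- The union of a regular set of regular sets is regular. -/
theorem isRegularSet_biUnion {S : Set (RegSet M)} (hS : IsRegularSet S) :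
    IsRegularSet (⋃ A ∈ S, A.1) := by
  induction hS with
  | empty => simpa using IsRegularSet.empty
  | single A => simpa using A.2
  | union _ _ ih₁ ih₂ => rw [Set.biUnion_union]; exact ih₁.union ih₂
  | @mul S T _ _ ih₁ ih₂ =>
    have h : (⋃ A ∈ S * T, A.1) = (⋃ A ∈ S, A.1) * (⋃ A ∈ T, A.1) := by
      ext x
      simp only [Set.mem_iUnion, Set.mem_mul, exists_prop]
      constructor
      · rintro ⟨_, ⟨A, hA, B, hB, rfl⟩, a, ha, b, hb, rfl⟩
        exact ⟨a, ⟨A, hA, ha⟩, b, ⟨B, hB, hb⟩, rfl⟩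
      · rintro ⟨a, ⟨A, hA, ha⟩, b, ⟨B, hB, hb⟩, rfl⟩
        exact ⟨A * B, ⟨A, hA, B, hB, rfl⟩, a, ha, b, hb, rfl⟩
    rw [h]; exact ih₁.mul ih₂
  | @star S _ ih =>
    have h : (⋃ A ∈ (Submonoid.closure S : Set (RegSet M)), A.1) =
        (Submonoid.closure (⋃ A ∈ S, A.1) : Set M) := by
      apply Set.Subset.antisymm
      · refine Set.iUnion₂_subset fun A hA => ?_
        refine Submonoid.closure_induction
          (motive := fun A _ => A.1 ⊆ (Submonoid.closure (⋃ A ∈ S, A.1) : Set M)) ?_ ?_ ?_ hA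
        · exact fun A hA => (Set.subset_biUnion_of_mem hA).trans Submonoid.subset_closure
        · rintro x rfl
          exact one_mem _
        · rintro A B _ _ hA hB _ ⟨a, ha, b, hb, rfl⟩
          exact mul_mem (hA ha) (hB hb)
      · intro x hx
        refine Submonoid.closure_induction
          (motive := fun x _ => x ∈ ⋃ A ∈ (Submonoid.closure S : Set (RegSet M)), A.1)
          ?_ ?_ ?_ hx
        · intro x hx
          simp only [Set.mem_iUnion, exists_prop] at hx ⊢
          obtain ⟨A, hA, hx⟩ := hx
          exact ⟨A, Submonoid.subset_closure hA, hx⟩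
        · simp only [Set.mem_iUnion, exists_prop]
          exact ⟨1, one_mem _, rfl⟩
        · intro x y _ _ hx hy
          simp only [Set.mem_iUnion, exists_prop] at hx hy ⊢
          obtain ⟨A, hA, hx⟩ := hx
          obtain ⟨B, hB, hy⟩ := hy
          exact ⟨A * B, mul_mem hA hB, x, hx, y, hy, rfl⟩
    rw [h]; exact ih.star

theorem isLUB_biUnion {S : Set (RegSet M)} (hS : IsRegularSet S) :
    IsLUB S ⟨⋃ A ∈ S, A.1, isRegularSet_biUnion hS⟩ :=
  ⟨fun _ hA => le_iff.2 (Set.subset_biUnion_of_mem (u := fun A : RegSet M => A.1) hA),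
    fun _ hB => le_iff.2 (Set.iUnion₂_subset fun _ hA => le_iff.1 (hB hA))⟩

instance : IsRDioid (RegSet M) where
  exists_isLUB _ hS := ⟨_, isLUB_biUnion hS⟩
  isLUB_mul S T a b hS hT ha hb := by
    rw [ha.unique (isLUB_biUnion hS), hb.unique (isLUB_biUnion hT)]
    constructor
    · rintro _ ⟨A, hA, B, hB, rfl⟩
      exact le_iff.2 (Set.mul_subset_mul
        (Set.subset_biUnion_of_mem (u := fun A : RegSet M => A.1) hA)
        (Set.subset_biUnion_of_mem (u := fun A : RegSet M => A.1) hB))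
    · intro C hC
      rw [le_iff]
      rintro _ ⟨x, hx, y, hy, rfl⟩
      simp only [Set.mem_iUnion, exists_prop] at hx hy
      obtain ⟨A, hA, hx⟩ := hx
      obtain ⟨B, hB, hy⟩ := hy
      exact le_iff.1 (hC ⟨A, hA, B, hB, rfl⟩) ⟨x, hx, y, hy, rfl⟩

end RegSet

/-! ### `R`-congruences and quotients -/

/-- The quotient of a dioid by a semiring congruence, with the order derived from its addition. -/
instance {D : Type*} [IdemSemiring D] (c : RingCon D) : IdemSemiring c.Quotient :=
  IdemSemiring.ofSemiring fun x => by
    induction x using Quotient.inductionOn' with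
    | h a => exact congrArg (fun d : D => (d : c.Quotient)) (add_idem a)

/-- An `R`-congruence: a semiring congruence `ρ` such that for regular `S`, `T` with suprema
`s`, `t`, if `(S/ρ)↓ = (T/ρ)↓` in the quotient, then `s/ρ = t/ρ`. -/
def IsRCongruence {D : Type*} [IdemSemiring D] (c : RingCon D) : Prop :=
  ∀ (S T : Set D) (s t : D), IsRegularSet S → IsRegularSet T → IsLUB S s → IsLUB T t →
    (lowerClosure (c.mk' '' S) : Set c.Quotient) = lowerClosure (c.mk' '' T) → c s t

/-- The least `R`-congruence containing a relation. -/
def rConGen {D : Type*} [IdemSemiring D] (r : D → D → Prop) : RingCon D :=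
  sInf {c | IsRCongruence c ∧ ∀ x y, r x y → c x y}

section Quotient

variable {D : Type*} [IdemSemiring D]

theorem mk_le_mk {c : RingCon D} {x y : D} : c.mk' x ≤ c.mk' y ↔ c (x + y) y := by
  rw [← add_eq_right_iff_le, ← map_add]
  exact RingCon.eq c

theorem lowerClosure_image_subset {c : RingCon D} {S T : Set D} :
    (lowerClosure (c.mk' '' S) : Set c.Quotient) ⊆ lowerClosure (c.mk' '' T) ↔
      ∀ s ∈ S, ∃ t ∈ T, c (s + t) t := by
  constructor
  · intro h s hs
    have : c.mk' s ∈ (lowerClosure (c.mk' '' T) : Set c.Quotient) :=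
      h (subset_lowerClosure ⟨s, hs, rfl⟩)
    obtain ⟨_, ⟨t, ht, rfl⟩, hst⟩ := this
    exact ⟨t, ht, mk_le_mk.1 hst⟩
  · rintro h x ⟨_, ⟨s, hs, rfl⟩, hx⟩
    obtain ⟨t, ht, hst⟩ := h s hs
    exact ⟨_, ⟨t, ht, rfl⟩, hx.trans (mk_le_mk.2 hst)⟩

theorem isRCongruence_rConGen (r : D → D → Prop) : IsRCongruence (rConGen r) := by
  intro S T s t hS hT hs ht h c hc
  refine hc.1 S T s t hS hT hs ht ?_
  obtain ⟨h₁, h₂⟩ := Set.Subset.antisymm_iff.1 h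
  rw [lowerClosure_image_subset] at h₁ h₂
  refine Set.Subset.antisymm (lowerClosure_image_subset.2 fun x hx => ?_)
    (lowerClosure_image_subset.2 fun x hx => ?_)
  · obtain ⟨y, hy, hxy⟩ := h₁ x hx
    exact ⟨y, hy, hxy c hc⟩
  · obtain ⟨y, hy, hxy⟩ := h₂ x hx
    exact ⟨y, hy, hxy c hc⟩

theorem rConGen_of_rel {r : D → D → Prop} {x y : D} (h : r x y) : rConGen r x y :=
  fun _ hc => hc.2 x y h

theorem IsRCongruence.isLUB_image {c : RingCon D} (hc : IsRCongruence c) {S : Set D} {s : D}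
    (hS : IsRegularSet S) (hs : IsLUB S s) : IsLUB (c.mk' '' S) (c.mk' s) := by
  constructor
  · rintro _ ⟨x, hx, rfl⟩
    rw [← add_eq_right_iff_le, ← map_add, add_eq_right_iff_le.2 (hs.1 hx)]
  · intro y hy
    obtain ⟨e, rfl⟩ := c.mk'_surjective y
    rw [mk_le_mk]
    refine hc (S ∪ {e}) {e} (s + e) e (hS.union (.single e)) (.single e) ?_ isLUB_singleton ?_
    · rw [add_eq_sup]
      exact hs.union isLUB_singleton
    · refine Set.Subset.antisymm (lowerClosure_image_subset.2 ?_) (lowerClosure_image_subset.2 ?_)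
      · rintro x (hx | rfl)
        · exact ⟨e, rfl, mk_le_mk.1 (hy ⟨x, hx, rfl⟩)⟩
        · exact ⟨x, rfl, mk_le_mk.1 le_rfl⟩
      · rintro x rfl
        exact ⟨x, Or.inr rfl, mk_le_mk.1 le_rfl⟩

theorem IsRCongruence.isRDioid [IsRDioid D] {c : RingCon D} (hc : IsRCongruence c) :
    IsRDioid c.Quotient where
  exists_isLUB A hA := by
    obtain ⟨S, hS, rfl⟩ := hA.exists_image_eq (c.mk' : D →* c.Quotient) c.mk'_surjective
    obtain ⟨s, hs⟩ := IsRDioid.exists_isLUB S hS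
    exact ⟨_, hc.isLUB_image hS hs⟩
  isLUB_mul A B a b hA hB ha hb := by
    obtain ⟨S, hS, rfl⟩ := hA.exists_image_eq (c.mk' : D →* c.Quotient) c.mk'_surjective
    obtain ⟨T, hT, rfl⟩ := hB.exists_image_eq (c.mk' : D →* c.Quotient) c.mk'_surjective
    obtain ⟨s, hs⟩ := IsRDioid.exists_isLUB S hS
    obtain ⟨t, ht⟩ := IsRDioid.exists_isLUB T hT
    rw [ha.unique (hc.isLUB_image hS hs), hb.unique (hc.isLUB_image hT ht), ← map_mul,
      ← Set.image_mul]
    exact hc.isLUB_image (hS.mul hT) (IsRDioid.isLUB_mul S T s t hS hT hs ht)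

end Quotient

/-- The quotient `D/ρ` by the least `R`-congruence `ρ` containing `r`. -/
def RQuotient {D : Type*} [IdemSemiring D] (r : D → D → Prop) : Type _ :=
  (rConGen r).Quotient

instance {D : Type*} [IdemSemiring D] (r : D → D → Prop) : IdemSemiring (RQuotient r) :=
  inferInstanceAs (IdemSemiring (rConGen r).Quotient)

instance {D : Type*} [IdemSemiring D] [IsRDioid D] (r : D → D → Prop) : IsRDioid (RQuotient r) :=
  (isRCongruence_rConGen r).isRDioid

/-- The class of an element. -/
def RQuotient.mk {D : Type*} [IdemSemiring D] (r : D → D → Prop) : D →+* RQuotient r :=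
  (rConGen r).mk'

/-! ### The polycyclic `R`-dioids -/

/-- The alphabet of `m` pairs of brackets. -/
inductive BracketLetter (m : ℕ)
  | opening (i : Fin m)
  | closing (i : Fin m)

/-- A bracket as a singleton regular set of words. -/
def bracketSet {m : ℕ} (x : BracketLetter m) : RegSet (FreeMonoid (BracketLetter m)) :=
  RegSet.single (FreeMonoid.of x)

/-- The match relations `pᵢ qⱼ = δᵢⱼ`. -/
def matchRel (m : ℕ) (A B : RegSet (FreeMonoid (BracketLetter m))) : Prop :=
  ∃ i j : Fin m, A = bracketSet (.opening i) * bracketSet (.closing j) ∧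
    B = if i = j then 1 else 0

/-- The polycyclic `R`-dioid over `m` bracket pairs. -/
abbrev Polycyclic (m : ℕ) : Type := RQuotient (matchRel m)

/-- The class of a bracket. -/
def Polycyclic.bracket {m : ℕ} (x : BracketLetter m) : Polycyclic m :=
  RQuotient.mk (matchRel m) (bracketSet x)

/-! ### The tensor product -/

/-- The tensor product equations `A × B = {(∑ A, ∑ B)}` for regular `A`, `B`. -/
def tensorRel (K₁ K₂ : Type*) [IdemSemiring K₁] [IdemSemiring K₂] (R S : RegSet (K₁ × K₂)) :
    Prop :=
  ∃ (A : Set K₁) (B : Set K₂) (a : K₁) (b : K₂) (hA : IsRegularSet A) (hB : IsRegularSet B),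
    IsLUB A a ∧ IsLUB B b ∧ R = ⟨A ×ˢ B, hA.prod hB⟩ ∧ S = RegSet.single (a, b)

/-- The tensor product of two `R`-dioids: the quotient of the regular subsets of the product of
the multiplicative monoids by the `R`-congruence generated by the tensor product equations. -/
abbrev RTensor (K₁ K₂ : Type*) [IdemSemiring K₁] [IdemSemiring K₂] : Type _ :=
  RQuotient (tensorRel K₁ K₂)

/-- `a ⊗ b`, the class of `{(a, b)}`. -/
def tmul {K₁ K₂ : Type*} [IdemSemiring K₁] [IdemSemiring K₂] (a : K₁) (b : K₂) : RTensor K₁ K₂ :=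
  RQuotient.mk (tensorRel K₁ K₂) (RegSet.single (a, b))

section

variable (K : Type*) [IdemSemiring K]

/-- The tensor product of `K` with the polycyclic `R`-dioid over two bracket pairs. -/
abbrev KC : Type _ := RTensor K (Polycyclic 2)

/-- The first opening bracket in the tensor product. -/
def bb : KC K := tmul 1 (Polycyclic.bracket (.opening 0))

/-- The second opening bracket in the tensor product. -/
def pp : KC K := tmul 1 (Polycyclic.bracket (.opening 1))

/-- The first closing bracket in the tensor product. -/
def dd : KC K := tmul 1 (Polycyclic.bracket (.closing 0))

/-- The second closing bracket in the tensor product. -/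
def qq : KC K := tmul 1 (Polycyclic.bracket (.closing 1))

/-- The centralizer of (the image of) the polycyclic `R`-dioid in the tensor product. -/
def centralizerC : Set (KC K) :=
  Set.centralizer (Set.range fun c : Polycyclic 2 => (tmul 1 c : KC K))

end

/-! ### Matrices -/

/-- Square matrices over a dioid form a dioid; the order is `A ≤ B ↔ A + B = B`. -/
instance {n D : Type*} [Fintype n] [DecidableEq n] [IdemSemiring D] :
    IdemSemiring (Matrix n n D) :=
  IdemSemiring.ofSemiring fun A => by ext i j; exact add_idem (A i j)

/-- The iteration of a matrix, by recursion on its dimension: for the splitting of `M` into blocks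
`A`, `B`, `C`, `E` with `A` of dimension `n` and `E` of dimension `1`, and `F = A + B E* C`,
the iteration of `M` consists of the blocks `F*`, `F* B E*`, `E* C F*` and
`E* C F* B E* + E*`. -/
def matStar {D : Type*} [IdemSemiring D] [IsRDioid D] :
    (n : ℕ) → Matrix (Fin n) (Fin n) D → Matrix (Fin n) (Fin n) D
  | 0, M => M
  | n + 1, M =>
    let M' : Matrix (Fin n ⊕ Fin 1) (Fin n ⊕ Fin 1) D :=
      Matrix.reindex finSumFinEquiv.symm finSumFinEquiv.symm M
    let A := M'.toBlocks₁₁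
    let B := M'.toBlocks₁₂
    let C := M'.toBlocks₂₁
    let E' : Matrix (Fin 1) (Fin 1) D := Matrix.of fun _ _ => rstar (M'.toBlocks₂₂ 0 0)
    let F' := matStar n (A + B * E' * C)
    Matrix.reindex finSumFinEquiv finSumFinEquiv
      (Matrix.fromBlocks F' (F' * B * E') (E' * C * F') (E' * C * F' * B * E' + E'))

/-! ### The Dyck language -/

/-- The letters of the Dyck language with one bracket pair and one neutral letter. -/
inductive DyckLetter
  | opening
  | neutral
  | closing

/-- The Dyck language: the least set of words that contains the empty word and the neutral
letter and is closed under concatenation and under enclosing a word in the brackets. -/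
inductive IsDyck : FreeMonoid DyckLetter → Prop
  | one : IsDyck 1
  | neutral : IsDyck (FreeMonoid.of .neutral)
  | mul {w w' : FreeMonoid DyckLetter} : IsDyck w → IsDyck w' → IsDyck (w * w')
  | enclose {w : FreeMonoid DyckLetter} : IsDyck w →
      IsDyck (FreeMonoid.of .opening * w * FreeMonoid.of .closing)

/-- The interpretation of the letters by elements of a set. -/
def DyckLetter.value {M : Type*} (u x v : M) : DyckLetter → M
  | .opening => u
  | .neutral => x
  | .closing => v

/-- The set of values in `M` of the words of the Dyck language over `{u, x, v}` with
brackets `u`, `v`. -/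
def dyckSet {M : Type*} [Monoid M] (u x v : M) : Set M :=
  FreeMonoid.lift (DyckLetter.value u x v) '' {w | IsDyck w}

end KleeneTensor

end

open KleeneTensor

namespace KleeneTensor

section Star

variable {D : Type*} [IdemSemiring D]

theorem matrix_le_iff {n : Type*} [Fintype n] [DecidableEq n] {A B : Matrix n n D} :
    A ≤ B ↔ ∀ i j, A i j ≤ B i j := by
  rw [← add_eq_right_iff_le, ← Matrix.ext_iff]
  exact forall₂_congr fun i j => add_eq_right_iff_le

variable [IsRDioid D]

theorem pow_le_rstar (c : D) (k : ℕ) : c ^ k ≤ rstar c :=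
  (isLUB_rstar c).1 (Submonoid.mem_closure_singleton.2 ⟨k, rfl⟩)

theorem mul_rstar_mul_le {a c b y : D} (h : ∀ k : ℕ, a * c ^ k * b ≤ y) :
    a * rstar c * b ≤ y := by
  have h₁ := IsRDioid.isLUB_mul {a} _ a _ (.single a) (IsRegularSet.single c).star
    isLUB_singleton (isLUB_rstar c)
  have h₂ := IsRDioid.isLUB_mul _ {b} _ b
    ((IsRegularSet.single a).mul (IsRegularSet.single c).star) (.single b) h₁ isLUB_singleton
  refine h₂.2 ?_
  rintro _ ⟨_, ⟨_, rfl, x, hx, rfl⟩, _, rfl, rfl⟩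
  obtain ⟨k, rfl⟩ := Submonoid.mem_closure_singleton.1 hx
  exact h k

theorem one_add_mul_rstar (c : D) : 1 + c * rstar c = rstar c := by
  apply le_antisymm
  · refine add_le (by simpa using pow_le_rstar c 0) ?_
    have h := mul_rstar_mul_le (a := c) (c := c) (b := 1) (y := rstar c) fun k => by
      rw [mul_one, ← pow_succ']; exact pow_le_rstar c _
    rwa [mul_one] at h
  · refine (isLUB_rstar c).2 fun x hx => ?_
    obtain ⟨k, rfl⟩ := Submonoid.mem_closure_singleton.1 hx
    cases k with
    | zero => rw [pow_zero, add_eq_sup]; exact le_sup_left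
    | succ k =>
      rw [pow_succ', add_eq_sup]
      exact le_sup_of_le_right (mul_le_mul_right (pow_le_rstar c k) c)

end Star

section MatrixStar

variable {D : Type*} [IdemSemiring D]

/-- `S` is a star-continuous iteration of the square matrix `M`. -/
structure IsContStar {m : Type*} [Fintype m] [DecidableEq m] (M S : Matrix m m D) : Prop where
  one_add_mul : 1 + M * S = S
  mul_mul_le : ∀ {r : ℕ} {A : Matrix (Fin r) m D} {B : Matrix m (Fin r) D}
    {Y : Matrix (Fin r) (Fin r) D}, (∀ k : ℕ, A * M ^ k * B ≤ Y) → A * S * B ≤ Y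

theorem isContStar_fin_one [IsRDioid D] (M : Matrix (Fin 1) (Fin 1) D) :
    IsContStar M (Matrix.of fun _ _ => rstar (M 0 0)) where
  one_add_mul := by
    ext i j
    fin_cases i; fin_cases j
    simpa [Matrix.mul_apply] using one_add_mul_rstar (M 0 0)
  mul_mul_le {r A B Y} h := by
    rw [matrix_le_iff]
    intro i j
    have hM (k : ℕ) : (M ^ k) 0 0 = M 0 0 ^ k := by
      induction k with
      | zero => simp
      | succ k ih => rw [pow_succ, pow_succ, Matrix.mul_apply]; simp [ih]
    have h' := mul_rstar_mul_le (a := A i 0) (c := M 0 0) (b := B 0 j) (y := Y i j) fun k => by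
      simpa [Matrix.mul_apply, hM] using matrix_le_iff.1 (h k) i j
    simpa [Matrix.mul_apply] using h'

variable {m₁ m₂ : Type*} [Fintype m₁] [DecidableEq m₁] [Fintype m₂] [DecidableEq m₂]

theorem IsContStar.reindex {M S : Matrix m₁ m₁ D} (h : IsContStar M S) (e : m₁ ≃ m₂) :
    IsContStar (Matrix.reindex e e M) (Matrix.reindex e e S) where
  one_add_mul := by
    conv_rhs => rw [← h.one_add_mul]
    ext i j
    simp [Matrix.mul_apply, Matrix.one_apply]
  mul_mul_le {r A B Y} hk := by
    have hpow (k : ℕ) : (Matrix.reindex e e M) ^ k = Matrix.reindex e e (M ^ k) := by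
      exact (map_pow (Matrix.reindexRingEquiv D e) M k).symm
    have key (T : Matrix m₁ m₁ D) :
        A * Matrix.reindex e e T * B = A.submatrix id e * T * B.submatrix e id := by
      ext i j
      simp [Matrix.mul_apply, ← Equiv.sum_comp e]
    rw [key]
    refine h.mul_mul_le fun k => ?_
    rw [← key, ← hpow]
    exact hk k

theorem IsContStar.fromBlocks {P : Matrix m₁ m₁ D} {Q : Matrix m₁ m₂ D} {R : Matrix m₂ m₁ D}
    {E E' : Matrix m₂ m₂ D} {F' : Matrix m₁ m₁ D} (hE : IsContStar E E')
    (hF : IsContStar (P + Q * E' * R) F') :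
    IsContStar (Matrix.fromBlocks P Q R E)
      (Matrix.fromBlocks F' (F' * Q * E') (E' * R * F') (E' * R * F' * Q * E' + E')) where
  one_add_mul := by
    have e₁ : E' * R * F' = R * F' + E * E' * R * F' := by
      conv_lhs => rw [← hE.one_add_mul]
      simp only [Matrix.add_mul, Matrix.one_mul]
    rw [← Matrix.fromBlocks_one, Matrix.fromBlocks_multiply, Matrix.fromBlocks_add]
    congr 1
    · conv_rhs => rw [← hF.one_add_mul]
      simp only [Matrix.add_mul, Matrix.mul_assoc]
    · conv_rhs => rw [← hF.one_add_mul]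
      simp only [Matrix.add_mul, Matrix.mul_add, Matrix.mul_assoc, Matrix.one_mul, zero_add]
      abel
    · conv_rhs => rw [e₁]
      simp only [Matrix.mul_assoc, zero_add]
    · conv_rhs => rw [e₁, ← hE.one_add_mul]
      conv_rhs => enter [1]; rw [hE.one_add_mul]
      simp only [Matrix.add_mul, Matrix.mul_add, Matrix.mul_assoc]
      abel
  mul_mul_le {r A B Y} h := by
    set M := Matrix.fromBlocks P Q R E with hM
    set G₁ : ℕ → Matrix m₁ (Fin r) D := fun k => (M ^ k * B).toRows₁ with hG₁
    set G₂ : ℕ → Matrix m₂ (Fin r) D := fun k => (M ^ k * B).toRows₂ with hG₂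
    have hG (k : ℕ) : M ^ k * B = Matrix.fromRows (G₁ k) (G₂ k) :=
      (Matrix.fromRows_toRows _).symm
    have hstep (k : ℕ) : Matrix.fromRows (G₁ (k + 1)) (G₂ (k + 1)) =
        Matrix.fromRows (P * G₁ k + Q * G₂ k) (R * G₁ k + E * G₂ k) := by
      rw [← hG, pow_succ', Matrix.mul_assoc, hG, hM, Matrix.fromBlocks_mul_fromRows]
    have hstep₁ (k : ℕ) : G₁ (k + 1) = P * G₁ k + Q * G₂ k :=
      (Matrix.fromRows_inj (hstep k)).1
    have hstep₂ (k : ℕ) : G₂ (k + 1) = R * G₁ k + E * G₂ k :=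
      (Matrix.fromRows_inj (hstep k)).2
    let T₁ (A₁ : Matrix (Fin r) m₁ D) : Prop := ∀ k, A₁ * G₁ k ≤ Y
    let T₂ (A₂ : Matrix (Fin r) m₂ D) : Prop := ∀ k, A₂ * G₂ k ≤ Y
    have add₁ {A₁ A₁'} (h : T₁ A₁) (h' : T₁ A₁') : T₁ (A₁ + A₁') := fun k => by
      rw [Matrix.add_mul]; exact add_le (h k) (h' k)
    have split₁ {A₁} (h : T₁ A₁) : T₁ (A₁ * P) ∧ T₂ (A₁ * Q) := by
      refine forall_and.1 fun k => ?_
      have := h (k + 1)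
      rw [hstep₁, Matrix.mul_add, ← Matrix.mul_assoc, ← Matrix.mul_assoc] at this
      exact ⟨le_trans (by rw [add_eq_sup]; exact le_sup_left) this,
        le_trans (by rw [add_eq_sup]; exact le_sup_right) this⟩
    have split₂ {A₂} (h : T₂ A₂) : T₁ (A₂ * R) ∧ T₂ (A₂ * E) := by
      refine forall_and.1 fun k => ?_
      have := h (k + 1)
      rw [hstep₂, Matrix.mul_add, ← Matrix.mul_assoc, ← Matrix.mul_assoc] at this
      exact ⟨le_trans (by rw [add_eq_sup]; exact le_sup_left) this,
        le_trans (by rw [add_eq_sup]; exact le_sup_right) this⟩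
    have starE {A₂} (h : T₂ A₂) : T₂ (A₂ * E') := fun k => by
      refine hE.mul_mul_le fun i => ?_
      have : T₂ (A₂ * E ^ i) := by
        induction i with
        | zero => simpa using h
        | succ i ih => rw [pow_succ, ← Matrix.mul_assoc]; exact (split₂ ih).2
      exact this k
    have starF {A₁} (h : T₁ A₁) : T₁ (A₁ * F') := fun k => by
      refine hF.mul_mul_le fun i => ?_
      have : T₁ (A₁ * (P + Q * E' * R) ^ i) := by
        induction i with
        | zero => simpa using h
        | succ i ih =>
          rw [pow_succ, ← Matrix.mul_assoc, Matrix.mul_add, ← Matrix.mul_assoc,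
            ← Matrix.mul_assoc]
          exact add₁ (split₁ ih).1 (split₂ (starE (split₁ ih).2)).1
      exact this k
    have h₀ (k : ℕ) : A.toCols₁ * G₁ k + A.toCols₂ * G₂ k ≤ Y := by
      have := h k
      rwa [Matrix.mul_assoc, hG, ← Matrix.fromCols_toCols A, Matrix.fromCols_mul_fromRows] at this
    have h₁ : T₁ A.toCols₁ := fun k =>
      le_trans (by rw [add_eq_sup]; exact le_sup_left) (h₀ k)
    have h₂ : T₂ A.toCols₂ := fun k =>
      le_trans (by rw [add_eq_sup]; exact le_sup_right) (h₀ k)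
    have hB : B = Matrix.fromRows (G₁ 0) (G₂ 0) := by rw [← hG, pow_zero, Matrix.one_mul]
    rw [hB, ← Matrix.fromCols_toCols A, Matrix.fromCols_mul_fromBlocks,
      Matrix.fromCols_mul_fromRows]
    simp only [Matrix.mul_add, Matrix.add_mul, ← Matrix.mul_assoc]
    have t₁ := starF h₁
    have t₂ := starE (split₁ t₁).2
    have t₃ := starE h₂
    have t₄ := starF (split₂ t₃).1
    have t₅ := starE (split₁ t₄).2
    exact add_le (add_le (t₁ 0) (t₄ 0)) (add_le (t₂ 0) (add_le (t₅ 0) (t₃ 0)))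

theorem isContStar_matStar [IsRDioid D] (n : ℕ) (M : Matrix (Fin n) (Fin n) D) :
    IsContStar M (matStar n M) := by
  induction n with
  | zero =>
    exact ⟨Subsingleton.elim _ _, fun {r A B Y} h => (congrArg (· ≤ Y) (by
      congr 2; exact Subsingleton.elim _ _)).mp (h 0)⟩
  | succ n ih =>
    set M' : Matrix (Fin n ⊕ Fin 1) (Fin n ⊕ Fin 1) D :=
      Matrix.reindex finSumFinEquiv.symm finSumFinEquiv.symm M with hM'
    have h := ((isContStar_fin_one M'.toBlocks₂₂).fromBlocks
      (P := M'.toBlocks₁₁) (Q := M'.toBlocks₁₂) (R := M'.toBlocks₂₁) (ih _)).reindex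
      finSumFinEquiv
    rw [Matrix.fromBlocks_toBlocks] at h
    convert h using 1
    simp [hM']
    rfl

theorem IsContStar.pow_le {M S : Matrix m₁ m₁ D} (h : IsContStar M S) (k : ℕ) : M ^ k ≤ S := by
  have h₁ : 1 + M * S ≤ S := h.one_add_mul.le
  rw [add_eq_sup, sup_le_iff] at h₁
  induction k with
  | zero => simpa using h₁.1
  | succ k ih =>
    rw [pow_succ']
    exact le_trans (mul_le_mul_right ih M) h₁.2

end MatrixStar

section DyckWords

/-- Every word is a Dyck word, or it has an unmatched closing bracket, or it has an unmatched
opening bracket. -/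
theorem isDyck_or_unmatched (w : FreeMonoid DyckLetter) :
    IsDyck w ∨ (∃ u v, IsDyck u ∧ w = u * FreeMonoid.of .closing * v) ∨
      ∃ u v, IsDyck v ∧ w = u * FreeMonoid.of .opening * v := by
  induction hn : w.length using Nat.strong_induction_on generalizing w with
  | _ n ih =>
  subst hn
  cases w using FreeMonoid.casesOn with
  | one => exact Or.inl .one
  | of_mul x w =>
    have hw := ih w.length (by simp) w rfl
    cases x with
    | closing => exact Or.inr (Or.inl ⟨1, w, .one, by simp⟩)
    | neutral =>
      obtain h | ⟨u, v, hu, rfl⟩ | ⟨u, v, hv, rfl⟩ := hw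
      · exact Or.inl (.mul .neutral h)
      · exact Or.inr (Or.inl ⟨_, v, .mul .neutral hu, by simp only [mul_assoc]⟩)
      · exact Or.inr (Or.inr ⟨FreeMonoid.of .neutral * u, v, hv, by simp only [mul_assoc]⟩)
    | opening =>
      obtain h | ⟨u, v, hu, rfl⟩ | ⟨u, v, hv, rfl⟩ := hw
      · exact Or.inr (Or.inr ⟨1, w, h, by simp⟩)
      · have hv := ih v.length (by simp; omega) v rfl
        obtain h | ⟨u', v', hu', rfl⟩ | ⟨u', v', hv', rfl⟩ := hv
        · refine Or.inl ?_
          simpa only [mul_assoc] using hu.enclose.mul h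
        · exact Or.inr (Or.inl ⟨_, v', hu.enclose.mul hu', by simp only [mul_assoc]⟩)
        · exact Or.inr (Or.inr ⟨FreeMonoid.of .opening * u * FreeMonoid.of .closing * u', v', hv',
            by simp only [mul_assoc]⟩)
      · exact Or.inr (Or.inr ⟨FreeMonoid.of .opening * u, v, hv, by simp only [mul_assoc]⟩)

end DyckWords

section Evaluation

/-- Evaluation of words in `{u, x, v}`. -/
abbrev evalWord {M : Type*} [Monoid M] (u x v : M) : FreeMonoid DyckLetter →* M :=
  FreeMonoid.lift (DyckLetter.value u x v)

variable {M : Type*} [Monoid M]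

theorem evalWord_opening (u x v : M) : evalWord u x v (FreeMonoid.of .opening) = u :=
  FreeMonoid.lift_eval_of _ _

theorem evalWord_neutral (u x v : M) : evalWord u x v (FreeMonoid.of .neutral) = x :=
  FreeMonoid.lift_eval_of _ _

theorem evalWord_closing (u x v : M) : evalWord u x v (FreeMonoid.of .closing) = v :=
  FreeMonoid.lift_eval_of _ _

/-- Induction for Dyck words whose opening and closing brackets carry the guards `p`, `q`: if `S`
is a submonoid that commutes with `p`, contains `x`, and is closed under `s ↦ u s v`, then the
guards do not change the values of Dyck words, and these values lie in `S`. -/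
theorem evalWord_guarded {u x v p q : M} (hpq : p * q = 1) (S : Submonoid M)
    (hp : ∀ s ∈ S, p * s = s * p) (hx : x ∈ S) (huv : ∀ s ∈ S, u * s * v ∈ S)
    {w : FreeMonoid DyckLetter} (hw : IsDyck w) :
    evalWord (u * p) x (q * v) w = evalWord u x v w ∧ evalWord u x v w ∈ S := by
  induction hw with
  | one => simp [one_mem]
  | neutral => simp only [evalWord_neutral, hx, and_self]
  | mul _ _ ih ih' =>
    simp only [map_mul, ih.1, ih'.1]
    exact ⟨trivial, mul_mem ih.2 ih'.2⟩
  | @enclose w _ ih =>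
    simp only [map_mul, evalWord_opening, evalWord_closing, ih.1]
    refine ⟨?_, huv _ ih.2⟩
    set s := evalWord u x v w
    calc u * p * s * (q * v) = u * (p * s) * q * v := by simp only [mul_assoc]
      _ = u * s * (p * q) * v := by rw [hp s ih.2]; simp only [mul_assoc]
      _ = u * s * v := by rw [hpq, mul_one]

end Evaluation

section Guarded

variable {R : Type*} [Semiring R]

/-- The value of `b w d` for a word `w` over the guarded letters is the plain value of `w` if `w`
is a Dyck word, and `0` otherwise. -/
theorem bracket_evalWord {u x v b p d q : R} (hbd : b * d = 1) (hpq : p * q = 1) (hbq : b * q = 0)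
    (hpd : p * d = 0) (S : Submonoid R) (hb : ∀ s ∈ S, b * s = s * b)
    (hp : ∀ s ∈ S, p * s = s * p) (hx : x ∈ S) (huv : ∀ s ∈ S, u * s * v ∈ S)
    (w : FreeMonoid DyckLetter) :
    (IsDyck w ∧ b * evalWord (u * p) x (q * v) w * d = evalWord u x v w ∧
      evalWord u x v w ∈ S) ∨ b * evalWord (u * p) x (q * v) w * d = 0 := by
  obtain h | ⟨w₁, w₂, h, rfl⟩ | ⟨w₁, w₂, h, rfl⟩ := isDyck_or_unmatched w
  · obtain ⟨h₁, h₂⟩ := evalWord_guarded hpq S hp hx huv h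
    refine Or.inl ⟨h, ?_, h₂⟩
    rw [h₁, hb _ h₂, mul_assoc, hbd, mul_one]
  · obtain ⟨h₁, h₂⟩ := evalWord_guarded hpq S hp hx huv h
    refine Or.inr ?_
    simp only [map_mul, evalWord_closing, h₁]
    rw [← mul_assoc b, ← mul_assoc b, hb _ h₂, ← mul_assoc (_ * b), mul_assoc _ b q, hbq]
    simp
  · obtain ⟨h₁, h₂⟩ := evalWord_guarded hpq S hp hx huv h
    refine Or.inr ?_
    simp only [map_mul, evalWord_opening, h₁]
    set s := evalWord u x v w₂
    set t := evalWord (u * p) x (q * v) w₁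
    calc b * (t * (u * p) * s) * d = b * t * u * (p * s) * d := by simp only [mul_assoc]
      _ = b * t * u * s * (p * d) := by rw [hp _ h₂]; simp only [mul_assoc]
      _ = 0 := by rw [hpd, mul_zero]

/-- An additively closed property of all `b w d` extends to `b (u + x + v)ᵏ d`. -/
theorem mul_add_pow_mul_mem {u x v b d : R} (P : AddSubsemigroup R)
    (h : ∀ w, b * evalWord u x v w * d ∈ P) (k : ℕ) : b * (u + x + v) ^ k * d ∈ P := by
  suffices H : ∀ w, b * (evalWord u x v w * (u + x + v) ^ k) * d ∈ P by
    simpa using H 1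
  induction k with
  | zero => simpa using h
  | succ k ih =>
    intro w
    rw [pow_succ', ← mul_assoc (evalWord u x v w), mul_add, mul_add, add_mul, add_mul, mul_add,
      mul_add, add_mul, add_mul]
    have h₁ := ih (w * FreeMonoid.of .opening)
    have h₂ := ih (w * FreeMonoid.of .neutral)
    have h₃ := ih (w * FreeMonoid.of .closing)
    simp only [map_mul, evalWord_opening, evalWord_neutral, evalWord_closing] at h₁ h₂ h₃
    exact add_mem (add_mem h₁ h₂) h₃

end Guarded

section OrderedGuarded

variable {R : Type*} [IdemSemiring R]

theorem exists_evalWord_le_pow (u x v : R) (w : FreeMonoid DyckLetter) :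
    ∃ k : ℕ, evalWord u x v w ≤ (u + x + v) ^ k := by
  induction w using FreeMonoid.inductionOn with
  | one => exact ⟨0, by simp⟩
  | of a =>
    refine ⟨1, ?_⟩
    rw [pow_one, add_eq_sup, add_eq_sup]
    cases a with
    | opening => rw [evalWord_opening]; exact le_sup_of_le_left le_sup_left
    | neutral => rw [evalWord_neutral]; exact le_sup_of_le_left le_sup_right
    | closing => rw [evalWord_closing]; exact le_sup_right
  | mul w w' ih ih' =>
    obtain ⟨k, hk⟩ := ih
    obtain ⟨l, hl⟩ := ih'
    exact ⟨k + l, by rw [map_mul, pow_add]; exact mul_le_mul' hk hl⟩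

theorem evalWord_le {u x v s : R} (h₁ : 1 ≤ s) (hx : x ≤ s) (hmul : s * s ≤ s)
    (huv : u * s * v ≤ s) {w : FreeMonoid DyckLetter} (hw : IsDyck w) : evalWord u x v w ≤ s := by
  induction hw with
  | one => simpa using h₁
  | neutral => simpa only [evalWord_neutral] using hx
  | mul _ _ ih ih' => rw [map_mul]; exact (mul_le_mul' ih ih').trans hmul
  | enclose _ ih =>
    simp only [map_mul, evalWord_opening, evalWord_closing]
    exact (mul_le_mul' (mul_le_mul' le_rfl ih) le_rfl).trans huv

end OrderedGuarded

section Matrices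

variable {D : Type*} [IdemSemiring D] {n : ℕ}

theorem IsContStar.mul_self_le {M S : Matrix (Fin n) (Fin n) D} (h : IsContStar M S) :
    S * S ≤ S := by
  have h₁ : M * S ≤ S := by
    conv_rhs => rw [← h.one_add_mul, add_eq_sup]
    exact le_sup_right
  have h₂ := h.mul_mul_le (A := 1) (B := S) (Y := S) fun k => by
    induction k with
    | zero => simp
    | succ k ih =>
      rw [one_mul] at ih ⊢
      rw [pow_succ, mul_assoc]
      exact (mul_le_mul' le_rfl h₁).trans ih
  rwa [one_mul] at h₂

variable {U X V b p d q S : Matrix (Fin n) (Fin n) D} {Z : Submonoid (Matrix (Fin n) (Fin n) D)}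

/-- Star-continuity of `b M* d`, where `M = U p + X + q V`, with respect to the values of Dyck
words. -/
theorem mul_bracket_star_mul_le (hS : IsContStar (U * p + X + q * V) S)
    (hbd : b * d = 1) (hpq : p * q = 1) (hbq : b * q = 0) (hpd : p * d = 0)
    (hb : ∀ s ∈ Z, b * s = s * b) (hp : ∀ s ∈ Z, p * s = s * p) (hx : X ∈ Z)
    (huv : ∀ s ∈ Z, U * s * V ∈ Z) {A B Y : Matrix (Fin n) (Fin n) D}
    (h : ∀ w, IsDyck w → evalWord U X V w ∈ Z → A * evalWord U X V w * B ≤ Y) :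
    A * (b * S * d) * B ≤ Y := by
  have := hS.mul_mul_le (A := A * b) (B := d * B) (Y := Y) fun k => by
    let P : AddSubsemigroup (Matrix (Fin n) (Fin n) D) :=
      { carrier := {m | m ≤ Y}
        add_mem' := fun {m m'} (hm : m ≤ Y) (hm' : m' ≤ Y) => (add_le hm hm' : m + m' ≤ Y) }
    refine mul_add_pow_mul_mem (P := P) (fun w => ?_) k
    have e : A * b * evalWord (U * p) X (q * V) w * (d * B) =
        A * (b * evalWord (U * p) X (q * V) w * d) * B := by simp only [mul_assoc]
    rw [e]
    obtain ⟨hw, h₁, h₂⟩ | h₁ := bracket_evalWord hbd hpq hbq hpd Z hb hp hx huv w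
    · rw [h₁]; exact h w hw h₂
    · rw [h₁, mul_zero, zero_mul]
      exact add_eq_right_iff_le.1 (zero_add Y)
  simpa only [mul_assoc] using this

/-- `b M* d`, where `M = U p + X + q V`, is the least upper bound of the values of Dyck words. -/
theorem isLUB_dyckSet (hS : IsContStar (U * p + X + q * V) S)
    (hbd : b * d = 1) (hpq : p * q = 1) (hbq : b * q = 0) (hpd : p * d = 0)
    (hb : ∀ s ∈ Z, b * s = s * b) (hp : ∀ s ∈ Z, p * s = s * p) (hx : X ∈ Z)
    (huv : ∀ s ∈ Z, U * s * V ∈ Z) : IsLUB (dyckSet U X V) (b * S * d) := by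
  constructor
  · rintro _ ⟨w, hw, rfl⟩
    obtain ⟨h₁, h₂⟩ := evalWord_guarded hpq Z hp hx huv hw
    obtain ⟨k, hk⟩ := exists_evalWord_le_pow (U * p) X (q * V) w
    calc evalWord U X V w = b * evalWord (U * p) X (q * V) w * d := by
          rw [h₁, hb _ h₂, mul_assoc, hbd, mul_one]
      _ ≤ b * S * d := mul_le_mul' (mul_le_mul' le_rfl (hk.trans (hS.pow_le k))) le_rfl
  · intro Y hY
    have := mul_bracket_star_mul_le (A := 1) (B := 1) (Y := Y) hS hbd hpq hbq hpd hb hp hx huv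
      fun w hw _ => by rw [one_mul, mul_one]; exact hY ⟨w, hw, rfl⟩
    rwa [one_mul, mul_one] at this

/-- `b M* d`, where `M = U p + X + q V`, is the least solution of `(U y V + X)* ≤ y`. -/
theorem isLeast_matStar_le [IsRDioid D] (hS : IsContStar (U * p + X + q * V) S)
    (hbd : b * d = 1) (hpq : p * q = 1) (hbq : b * q = 0) (hpd : p * d = 0)
    (hb : ∀ s ∈ Z, b * s = s * b) (hp : ∀ s ∈ Z, p * s = s * p) (hx : X ∈ Z)
    (huv : ∀ s ∈ Z, U * s * V ∈ Z) :
    IsLeast {Y | matStar n (U * Y * V + X) ≤ Y} (b * S * d) := by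
  have hN := isLUB_dyckSet hS hbd hpq hbq hpd hb hp hx huv
  have ind {A B Y : Matrix (Fin n) (Fin n) D}
      (h : ∀ w, IsDyck w → A * evalWord U X V w * B ≤ Y) : A * (b * S * d) * B ≤ Y :=
    mul_bracket_star_mul_le hS hbd hpq hbq hpd hb hp hx huv fun w hw _ => h w hw
  set N := b * S * d
  have le_N {w} (hw : IsDyck w) : evalWord U X V w ≤ N := hN.1 ⟨w, hw, rfl⟩
  constructor
  · have h₁ : 1 ≤ N := by simpa using le_N .one
    have hX : X ≤ N := by simpa only [evalWord_neutral] using le_N .neutral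
    have hUV : U * N * V ≤ N := ind fun w hw => by
      simpa only [map_mul, evalWord_opening, evalWord_closing] using le_N hw.enclose
    have hmul : N * N ≤ N := by
      have := ind (A := 1) (B := N) (Y := N) fun w hw => by
        have := ind (A := evalWord U X V w) (B := 1) (Y := N) fun w' hw' => by
          rw [mul_one, ← map_mul]; exact le_N (hw.mul hw')
        rwa [one_mul, ← mul_one N, ← mul_assoc, mul_one N]
      rwa [one_mul] at this
    have hM : U * N * V + X ≤ N := add_le hUV hX
    have := (isContStar_matStar n (U * N * V + X)).mul_mul_le (A := 1) (B := 1) (Y := N)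
      fun k => by
        rw [one_mul, mul_one]
        induction k with
        | zero => simpa using h₁
        | succ k ih => rw [pow_succ]; exact (mul_le_mul' ih hM).trans hmul
    rwa [one_mul, mul_one] at this
  · intro Y hY
    have hT := isContStar_matStar n (U * Y * V + X)
    change matStar n (U * Y * V + X) ≤ Y at hY
    set T := matStar n (U * Y * V + X)
    have hM := hT.pow_le 1
    rw [pow_one, add_eq_sup, sup_le_iff] at hM
    refine hN.2 ?_
    rintro _ ⟨w, hw, rfl⟩
    exact (evalWord_le (by simpa using hT.pow_le 0) hM.2 hT.mul_self_le
      ((mul_le_mul' (mul_le_mul' le_rfl hY) le_rfl).trans hM.1) hw).trans hY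

/-- An element that commutes with `Z` commutes with `b M* d`, where `M = U p + X + q V`. -/
theorem commute_bracket_star (hS : IsContStar (U * p + X + q * V) S)
    (hbd : b * d = 1) (hpq : p * q = 1) (hbq : b * q = 0) (hpd : p * d = 0)
    (hb : ∀ s ∈ Z, b * s = s * b) (hp : ∀ s ∈ Z, p * s = s * p) (hx : X ∈ Z)
    (huv : ∀ s ∈ Z, U * s * V ∈ Z) {c : Matrix (Fin n) (Fin n) D}
    (hc : ∀ s ∈ Z, c * s = s * c) : Commute c (b * S * d) := by
  have hN := isLUB_dyckSet hS hbd hpq hbq hpd hb hp hx huv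
  apply le_antisymm
  · have := mul_bracket_star_mul_le (A := c) (B := 1) (Y := b * S * d * c) hS hbd hpq hbq hpd
      hb hp hx huv fun w hw hwZ => by
        rw [mul_one, hc _ hwZ]
        exact mul_le_mul' (hN.1 ⟨w, hw, rfl⟩) le_rfl
    rwa [mul_one] at this
  · have := mul_bracket_star_mul_le (A := 1) (B := c) (Y := c * (b * S * d)) hS hbd hpq hbq hpd
      hb hp hx huv fun w hw hwZ => by
        rw [one_mul, ← hc _ hwZ]
        exact mul_le_mul' le_rfl (hN.1 ⟨w, hw, rfl⟩)
    rwa [one_mul] at this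

end Matrices

section Tensor

variable (K : Type*) [IdemSemiring K]

theorem tmul_mul_tmul {K₁ K₂ : Type*} [IdemSemiring K₁] [IdemSemiring K₂] (a a' : K₁)
    (c c' : K₂) : tmul a c * tmul a' c' = tmul (a * a') (c * c') := by
  rw [tmul, tmul, tmul, ← map_mul]
  congr 1
  exact Subtype.ext (Set.singleton_mul_singleton)

theorem tmul_one_one {K₁ K₂ : Type*} [IdemSemiring K₁] [IdemSemiring K₂] :
    tmul (1 : K₁) (1 : K₂) = 1 :=
  map_one (RQuotient.mk (tensorRel K₁ K₂))

theorem RQuotient.mk_eq_of_rel {D : Type*} [IdemSemiring D] {r : D → D → Prop} {x y : D}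
    (h : r x y) : RQuotient.mk r x = RQuotient.mk r y :=
  (RingCon.eq _).2 (rConGen_of_rel h)

theorem tmul_zero {K₁ K₂ : Type*} [IdemSemiring K₁] [IdemSemiring K₂] (a : K₁) :
    tmul a (0 : K₂) = 0 := by
  rw [← map_zero (RQuotient.mk (tensorRel K₁ K₂))]
  refine (RQuotient.mk_eq_of_rel ⟨{a}, ∅, a, 0, .single a, .empty, isLUB_singleton, ?_,
    Subtype.ext Set.prod_empty.symm, rfl⟩).symm
  rw [isLUB_empty_iff]
  exact fun x => add_eq_right_iff_le.1 (zero_add x)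

theorem Polycyclic.opening_mul_closing {m : ℕ} (i j : Fin m) :
    bracket (.opening i) * bracket (.closing j) = if i = j then 1 else 0 := by
  rw [bracket, bracket, ← map_mul, RQuotient.mk_eq_of_rel ⟨i, j, rfl, rfl⟩]
  split_ifs <;> simp

theorem bb_mul_dd : bb K * dd K = 1 := by
  rw [bb, dd, tmul_mul_tmul, Polycyclic.opening_mul_closing, mul_one, if_pos rfl, tmul_one_one]

theorem pp_mul_qq : pp K * qq K = 1 := by
  rw [pp, qq, tmul_mul_tmul, Polycyclic.opening_mul_closing, mul_one, if_pos rfl, tmul_one_one]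

theorem bb_mul_qq : bb K * qq K = 0 := by
  rw [bb, qq, tmul_mul_tmul, Polycyclic.opening_mul_closing, if_neg (by decide), tmul_zero]

theorem pp_mul_dd : pp K * dd K = 0 := by
  rw [pp, dd, tmul_mul_tmul, Polycyclic.opening_mul_closing, if_neg (by decide), tmul_zero]

/-- The centralizer of the polycyclic dioid, as a subsemiring. -/
def centralizerSubsemiring : Subsemiring (KC K) :=
  Subsemiring.centralizer (Set.range fun c : Polycyclic 2 => (tmul 1 c : KC K))

variable {K}

theorem tmul_mul_comm {z : KC K} (hz : z ∈ centralizerC K) (c : Polycyclic 2) :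
    tmul 1 c * z = z * tmul 1 c :=
  hz _ ⟨c, rfl⟩

theorem mul_mem_zero_one {u v : KC K} (hu : u ∈ ({0, bb K, pp K} : Set (KC K)))
    (hv : v ∈ ({0, dd K, qq K} : Set (KC K))) : u * v = 0 ∨ u * v = 1 := by
  obtain rfl | rfl | rfl := hu <;> obtain rfl | rfl | rfl := hv <;>
    simp [bb_mul_dd, bb_mul_qq, pp_mul_dd, pp_mul_qq]

theorem mul_comm_of_mem {u z : KC K} (hu : u ∈ ({0, bb K, pp K} : Set (KC K)))
    (hz : z ∈ centralizerC K) : u * z = z * u := by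
  obtain rfl | rfl | rfl := hu
  · simp
  · exact tmul_mul_comm hz _
  · exact tmul_mul_comm hz _

theorem mul_mul_mem_centralizer {u z v : KC K} (hu : u ∈ ({0, bb K, pp K} : Set (KC K)))
    (hz : z ∈ centralizerC K) (hv : v ∈ ({0, dd K, qq K} : Set (KC K))) :
    u * z * v ∈ centralizerSubsemiring K := by
  rw [mul_comm_of_mem hu hz, mul_assoc]
  obtain h | h := mul_mem_zero_one hu hv
  · rw [h, mul_zero]; exact zero_mem _
  · rw [h, mul_one]; exact hz

/-- The square matrices over the centralizer of the polycyclic dioid. -/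
def centralizerMatrix (K : Type*) [IdemSemiring K] (n : ℕ) :
    Submonoid (Matrix (Fin n) (Fin n) (KC K)) :=
  (centralizerSubsemiring K).matrix.toSubmonoid

theorem mul_mul_mem_centralizerMatrix {n : ℕ} {U s V : Matrix (Fin n) (Fin n) (KC K)}
    (hU : ∀ i j, U i j ∈ ({0, bb K, pp K} : Set (KC K)))
    (hV : ∀ i j, V i j ∈ ({0, dd K, qq K} : Set (KC K)))
    (hs : s ∈ centralizerMatrix K n) : U * s * V ∈ centralizerMatrix K n := by
  intro i j
  rw [Matrix.mul_apply]
  refine sum_mem fun l _ => ?_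
  rw [Matrix.mul_apply, Finset.sum_mul]
  exact sum_mem fun k _ => mul_mul_mem_centralizer (hU i k) (hs k l) (hV l j)

theorem scalar_tmul_mul_comm {n : ℕ} {s : Matrix (Fin n) (Fin n) (KC K)}
    (hs : s ∈ centralizerMatrix K n) (c : Polycyclic 2) :
    Matrix.scalar (Fin n) (tmul 1 c) * s = s * Matrix.scalar (Fin n) (tmul 1 c) := by
  ext i j
  simpa using tmul_mul_comm (hs i j) c

end Tensor

end KleeneTensor

theorem mainTheorem3 {K : Type*} [IdemSemiring K] [IsRDioid K] (n : ℕ)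
    (U X V : Matrix (Fin n) (Fin n) (KC K))
    (hU : ∀ i j, U i j ∈ ({0, bb K, pp K} : Set (KC K)))
    (hX : ∀ i j, X i j ∈ centralizerC K)
    (hV : ∀ i j, V i j ∈ ({0, dd K, qq K} : Set (KC K)))
    (N : Matrix (Fin n) (Fin n) (KC K))
    (hN : N = Matrix.scalar (Fin n) (bb K) *
      matStar n (U * Matrix.scalar (Fin n) (pp K) + X + Matrix.scalar (Fin n) (qq K) * V) *
      Matrix.scalar (Fin n) (dd K)) :
    IsLeast {Y : Matrix (Fin n) (Fin n) (KC K) | matStar n (U * Y * V + X) ≤ Y} N ∧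
      IsLUB (dyckSet U X V) N ∧
      ∀ i j, N i j ∈ centralizerC K := by
  subst hN
  have hS := isContStar_matStar n
    (U * Matrix.scalar (Fin n) (pp K) + X + Matrix.scalar (Fin n) (qq K) * V)
  have hbd : Matrix.scalar (Fin n) (bb K) * Matrix.scalar (Fin n) (dd K) = 1 := by
    rw [← map_mul, bb_mul_dd, map_one]
  have hpq : Matrix.scalar (Fin n) (pp K) * Matrix.scalar (Fin n) (qq K) = 1 := by
    rw [← map_mul, pp_mul_qq, map_one]
  have hbq : Matrix.scalar (Fin n) (bb K) * Matrix.scalar (Fin n) (qq K) = 0 := by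
    rw [← map_mul, bb_mul_qq, map_zero]
  have hpd : Matrix.scalar (Fin n) (pp K) * Matrix.scalar (Fin n) (dd K) = 0 := by
    rw [← map_mul, pp_mul_dd, map_zero]
  have hc (c : Polycyclic 2) : ∀ s ∈ centralizerMatrix K n,
      Matrix.scalar (Fin n) (tmul 1 c) * s = s * Matrix.scalar (Fin n) (tmul 1 c) :=
    fun s hs => scalar_tmul_mul_comm hs c
  have huv : ∀ s ∈ centralizerMatrix K n, U * s * V ∈ centralizerMatrix K n :=
    fun s hs => mul_mul_mem_centralizerMatrix hU hV hs
  refine ⟨isLeast_matStar_le hS hbd hpq hbq hpd (hc _) (hc _) hX huv,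
    isLUB_dyckSet hS hbd hpq hbq hpd (hc _) (hc _) hX huv, ?_⟩
  rintro i j _ ⟨c, rfl⟩
  have h := commute_bracket_star hS hbd hpq hbq hpd (hc _) (hc _) hX huv (hc c)
  simpa using congrFun (congrFun h.eq i) j
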